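/- Let $R$ be a finite field of order $q$ and let $n\ge 2$ be an integer. A frieze of width $n$ over $R$ is a function $(i,j)\mapsto m_{i,j}$ from $\{(i,j)\in\mathbb{Z}\times\mathbb{Z}: 0\le i-j\le n\}$ to $R$ such that $m_{i,i}=m_{n+i,i}=0$ for all $i\in\mathbb{Z}$, and $m_{i,j}m_{i+1,j+1}-m_{i,j+1}m_{i+1,j}=1$ whenever $0<i-j<n$. It is regular if $m_{i+1,i}=m_{n+i-1,i}=1$ for all $i\in\mathbb{Z}$, and tame if \[ \det\begin{pmatrix}m_{i-1,j-1}&m_{i-1,j}&m_{i-1,j+1}\\ m_{i,j-1}&m_{i,j}&m_{i,j+1}\\ m_{i+1,j-1}&m_{i+1,j}&m_{i+1,j+1}\end{pmatrix}=0\qquad\text{whenever } 1<i-j<n-1. \] Write \[ [m]_{q^2}=\frac{q^{2m}-1}{q^2-1}\quad\text{and}\quad \binom{m}{2}_{\!q}=\frac{(q^m-1)(q^{m-1}-1)}{(q-1)(q^2-1)}. \] Then the number $\alpha_n$ of tame regular friezes of width $n$ over $R$ is finite and equals \[ \alpha_n=\begin{cases} [m]_{q^2}, & \text{if } n=2m+1,\\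 (q-1)\binom{m}{2}_{\!q}, & \text{if } n=2m \text{ with } m \text{ even and } \operatorname{char} R\neq 2,\\ (q-1)\binom{m}{2}_{\!q}+q^{m-1}, & \text{if } n=2m \text{ with } m \text{ odd or } \operatorname{char} R=2. \end{cases} \] -/

import Mathlib

/-- The strip `{(i, j) ∈ ℤ × ℤ : 0 ≤ i - j ≤ n}` on which a frieze of width `n` is defined. -/
def friezeStrip (n : ℕ) : Set (ℤ × ℤ) :=
  {p | 0 ≤ p.1 - p.2 ∧ p.1 - p.2 ≤ n}

/-- The value at `(i, j)` of a function on the strip of width `n`. -/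
def stripEntry {R : Type*} {n : ℕ} (F : friezeStrip n → R) (i j : ℤ)
    (h₀ : 0 ≤ i - j) (h₁ : i - j ≤ n) : R :=
  F ⟨(i, j), h₀, h₁⟩

/-- A frieze of width `n` over a commutative ring `R`: a function on the strip `0 ≤ i - j ≤ n`
with zeros in the top and bottom rows, and satisfying the diamond rule. -/
@[ext]
structure Frieze (R : Type*) [CommRing R] (n : ℕ) where
  /-- The underlying function. -/
  toFun : friezeStrip n → R
  top_row : ∀ i : ℤ, stripEntry toFun i i (by omega) (by omega) = 0
  bottom_row : ∀ i : ℤ, stripEntry toFun (n + i) i (by omega) (by omega) = 0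
  diamond : ∀ (i j : ℤ) (_ : 0 < i - j) (_ : i - j < n),
    stripEntry toFun i j (by omega) (by omega) *
        stripEntry toFun (i + 1) (j + 1) (by omega) (by omega) -
      stripEntry toFun i (j + 1) (by omega) (by omega) *
        stripEntry toFun (i + 1) j (by omega) (by omega) = 1

namespace Frieze

/-- The entry `m_{i,j}` of a frieze, for `0 ≤ i - j ≤ n`. -/
def entry {R : Type*} [CommRing R] {n : ℕ} (F : Frieze R n) (i j : ℤ)
    (h₀ : 0 ≤ i - j) (h₁ : i - j ≤ n) : R :=
  stripEntry F.toFun i j h₀ h₁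

/-- A frieze is tame if all the 3-by-3 determinants of contiguous entries that fit inside the
strip vanish; such a determinant, centred at `(i, j)`, fits exactly if `1 < i - j < n - 1`. -/
def IsTame {R : Type*} [CommRing R] {n : ℕ} (F : Frieze R n) : Prop :=
  ∀ (i j : ℤ) (_ : 1 < i - j) (_ : i - j < (n : ℤ) - 1),
    Matrix.det
      !![F.entry (i - 1) (j - 1) (by omega) (by omega),
          F.entry (i - 1) j (by omega) (by omega),
          F.entry (i - 1) (j + 1) (by omega) (by omega);
        F.entry i (j - 1) (by omega) (by omega),
          F.entry i j (by omega) (by omega),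
          F.entry i (j + 1) (by omega) (by omega);
        F.entry (i + 1) (j - 1) (by omega) (by omega),
          F.entry (i + 1) j (by omega) (by omega),
          F.entry (i + 1) (j + 1) (by omega) (by omega)] = 0

/-- A frieze is regular if its second and its second-last row consist of `1`s only. The
hypothesis `1 ≤ n` only says that these two rows exist. -/
def IsRegular {R : Type*} [CommRing R] {n : ℕ} (F : Frieze R n) : Prop :=
  ∀ (_ : 1 ≤ n) (i : ℤ),
    F.entry (i + 1) i (by omega) (by omega) = 1 ∧
      F.entry (n + i - 1) i (by omega) (by omega) = 1

end Frieze

/-- The `q`-integer `[m]_q = (q ^ m - 1) / (q - 1)`, for `q ≠ 1`. -/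
def qInteger (q : ℚ) (m : ℕ) : ℚ :=
  (q ^ m - 1) / (q - 1)

/-- The `q`-binomial coefficient `m` choose `2`,
`(q ^ m - 1) (q ^ (m - 1) - 1) / ((q - 1) (q ^ 2 - 1))`, for `m ≥ 1` and `q ≠ ± 1`. -/
def qBinomialTwo (q : ℚ) (m : ℕ) : ℚ :=
  ((q ^ m - 1) * (q ^ (m - 1) - 1)) / ((q - 1) * (q ^ 2 - 1))

/-!
A tame regular frieze of width `n` is determined by its third row `c_j = m_{j+1,j-1}`. Tameness
says that adjacent columns satisfy `m_{i,j-1} = c_j m_{i,j} - m_{i,j+1}`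
(`Frieze.column_recurrence`), so that `m_{i,j} = det (v_j, v_i)` for vectors `v_j` in the plane
with `v_{j+1} = c_j v_j - v_{j-1}` and `det (v_j, v_{j+1}) = 1` (`Frieze.entry_eq_columnDet`). The
last two rows of a regular frieze say exactly that `v_{j+n} = -v_j`. Hence the friezes correspond
to the words `c₀, …, c_{n-1}` over `R` with `M(c₀) ⋯ M(c_{n-1}) = -1` in `SL₂(R)`, where
`M(a) = !![a, -1; 1, 0]` (`Frieze.quiddityCycle_bijective`).

These words are counted by shortening them at the second letter. If it is `0`, then
`M(a) M(0) M(b) = -M(a + b)`; if it is invertible, say `d⁻¹`, then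
`M(a) M(d⁻¹) M(b) = D(d) M(d⁻²(a - d)) M(b - d)` with `D(d)` diagonal. So the number `f_n(g)` of
words with product `g` satisfies `f_{n+3}(g) = q f_{n+1}(-g) + ∑_d f_{n+2}(D(d) g)`
(`wordCount_add_three`). The sums `S_n = ∑_d f_n(D(d))` then satisfy a linear recursion of order
two, with solution `(q + 1) S_{k+1} = q^k - (-1)^k` (`torusWordCount_succ`), and
`f_{n+3}(D(d)) = q f_{n+1}(D(-d)) + S_{n+2}` gives `f_n` on the diagonal matrices (`wordCount_odd`,
`wordCount_even`). The initial value `f_2(D(d))` is `1` for `d = -1` and `0` otherwise, which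
accounts for the dependence on the parity of `n / 2` and on whether `1 = -1`.
-/

open Matrix (SpecialLinearGroup)

/-! ### Relations between the matrices -/

/-- The matrix `M(a) = !![a, -1; 1, 0]`. Right multiplication by it turns a pair of columns
`(v, -u)` into `(a v - u, -v)`, one step of the recurrence satisfied by the columns of a frieze. -/
def stepMatrix {R : Type*} [CommRing R] (a : R) : SpecialLinearGroup (Fin 2) R :=
  ⟨!![a, -1; 1, 0], by simp [Matrix.det_fin_two]⟩

/-- The diagonal matrix `D(d)` with entries `d`, `d⁻¹`. -/
def torusMatrix {R : Type*} [CommRing R] (d : Rˣ) : SpecialLinearGroup (Fin 2) R :=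
  ⟨!![(d : R), 0; 0, ((d⁻¹ : Rˣ) : R)], by simp [Matrix.det_fin_two]⟩

theorem coe_stepMatrix {R : Type*} [CommRing R] (a : R) :
    (stepMatrix a : Matrix (Fin 2) (Fin 2) R) = !![a, -1; 1, 0] :=
  rfl

theorem coe_torusMatrix {R : Type*} [CommRing R] (d : Rˣ) :
    (torusMatrix d : Matrix (Fin 2) (Fin 2) R) = !![(d : R), 0; 0, ((d⁻¹ : Rˣ) : R)] :=
  rfl

theorem stepMatrix_injective {R : Type*} [CommRing R] :
    Function.Injective (stepMatrix : R → SpecialLinearGroup (Fin 2) R) := by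
  intro a b h
  have := congrArg (fun A : SpecialLinearGroup (Fin 2) R => A.1 0 0) h
  simpa [coe_stepMatrix] using this

theorem torusMatrix_mul {R : Type*} [CommRing R] (d e : Rˣ) :
    torusMatrix d * torusMatrix e = torusMatrix (d * e) := by
  ext i j
  fin_cases i <;> fin_cases j <;> simp [coe_torusMatrix, mul_comm]

theorem torusMatrix_one {R : Type*} [CommRing R] : torusMatrix (1 : Rˣ) = 1 := by
  ext i j
  fin_cases i <;> fin_cases j <;> simp [coe_torusMatrix]

theorem neg_torusMatrix {R : Type*} [CommRing R] (d : Rˣ) :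
    -torusMatrix d = torusMatrix (-d) := by
  ext i j
  fin_cases i <;> fin_cases j <;> simp [coe_torusMatrix, inv_neg]

theorem inv_torusMatrix {R : Type*} [CommRing R] (d : Rˣ) :
    (torusMatrix d)⁻¹ = torusMatrix d⁻¹ :=
  inv_eq_of_mul_eq_one_right (by rw [torusMatrix_mul, mul_inv_cancel, torusMatrix_one])

/-- A letter `0` can be removed from a word, at the price of a sign. -/
theorem stepMatrix_mul_zero_mul {R : Type*} [CommRing R] (a b : R) :
    stepMatrix a * stepMatrix 0 * stepMatrix b = -stepMatrix (a + b) := by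
  ext i j
  fin_cases i <;> fin_cases j <;> simp [coe_stepMatrix]

/-- An invertible letter can be removed from a word, at the price of a diagonal factor. For a fixed
letter `d⁻¹`, the new neighbours run through all pairs when `a` and `b` do. -/
theorem stepMatrix_mul_inv_mul {R : Type*} [CommRing R] (a b : R) (d : Rˣ) :
    stepMatrix a * stepMatrix ((d⁻¹ : Rˣ) : R) * stepMatrix b =
      torusMatrix d * stepMatrix (((d⁻¹ ^ 2 : Rˣ) : R) * (a - d)) * stepMatrix (b - d) := by
  have h : (d : R) * ((d⁻¹ : Rˣ) : R) = 1 := by simp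
  ext i j
  fin_cases i <;> fin_cases j <;> simp [coe_stepMatrix, coe_torusMatrix] <;> grind

/-! ### Counting words by their product -/

/-- The number of words `c₀, …, c_{n-1}` over `R` with `M(c₀) ⋯ M(c_{n-1}) = g`. -/
noncomputable def wordCount {R : Type*} [CommRing R] (n : ℕ)
    (g : SpecialLinearGroup (Fin 2) R) : ℕ :=
  Nat.card {c : Fin n → R // (List.ofFn fun i => stepMatrix (c i)).prod = g}

theorem wordCount_succ {R : Type*} [CommRing R] [Fintype R] (n : ℕ)
    (g : SpecialLinearGroup (Fin 2) R) :
    wordCount (n + 1) g = ∑ a : R, wordCount n ((stepMatrix a)⁻¹ * g) := by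
  classical
  unfold wordCount
  rw [← Nat.card_sigma]
  refine Nat.card_congr
    { toFun := fun c => ⟨c.1 0, Fin.tail c.1, ?_⟩
      invFun := fun c => ⟨Fin.cons c.1 c.2.1, ?_⟩
      left_inv := ?_
      right_inv := ?_ }
  · have := c.2
    rw [List.ofFn_succ, List.prod_cons] at this
    rwa [eq_inv_mul_iff_mul_eq]
  · have := c.2.2
    rw [eq_inv_mul_iff_mul_eq] at this
    rw [List.ofFn_succ, List.prod_cons]
    simpa using this
  · intro c
    simp
  · rintro ⟨a, c, hc⟩
    rfl

theorem sum_eq_add_sum_units_inv {K A : Type*} [Field K] [Fintype K] [DecidableEq K]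
    [AddCommMonoid A] (h : K → A) :
    ∑ u, h u = h 0 + ∑ d : Kˣ, h ((d⁻¹ : Kˣ) : K) := by
  have hinv := Equiv.sum_comp (Equiv.inv Kˣ) (fun d : Kˣ => h d)
  simp only [Equiv.inv_apply] at hinv
  rw [hinv, Fintype.sum_eq_add_sum_compl 0]
  congr 1
  refine Finset.sum_bij' (fun u hu => Units.mk0 u (by simpa using hu)) (fun d _ => (d : K))
    ?_ ?_ ?_ ?_ ?_ <;> simp

/-- The recursion for `wordCount`, by cases on whether the second letter vanishes. -/
theorem wordCount_add_three {K : Type*} [Field K] [Fintype K] [DecidableEq K] (n : ℕ)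
    (g : SpecialLinearGroup (Fin 2) K) :
    wordCount (n + 3) g = Fintype.card K * wordCount (n + 1) (-g) +
      ∑ d : Kˣ, wordCount (n + 2) (torusMatrix d * g) := by
  have h3 : wordCount (n + 3) g = ∑ u : K, ∑ a : K, ∑ b : K,
      wordCount n ((stepMatrix a * stepMatrix u * stepMatrix b)⁻¹ * g) := by
    rw [Finset.sum_comm]
    simp only [wordCount_succ, _root_.mul_inv_rev, mul_assoc]
  rw [h3, sum_eq_add_sum_units_inv]
  congr 1
  · have hb : ∀ a : K, ∑ b : K,
        wordCount n ((stepMatrix a * stepMatrix 0 * stepMatrix b)⁻¹ * g) =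
        wordCount (n + 1) (-g) := by
      intro a
      rw [wordCount_succ, ← Equiv.sum_comp (Equiv.addLeft a)
        (fun b => wordCount n ((stepMatrix b)⁻¹ * -g))]
      refine Finset.sum_congr rfl fun b _ => ?_
      rw [stepMatrix_mul_zero_mul]
      congr 1
      simp [inv_neg]
    simp only [hb]
    simp
  -- Sort by the inverse of the second letter; then shift and rescale the two neighbours.
  · rw [← Equiv.sum_comp (Equiv.inv Kˣ) (fun d => wordCount (n + 2) (torusMatrix d * g))]
    refine Finset.sum_congr rfl fun d _ => ?_
    simp only [Equiv.inv_apply, ← inv_torusMatrix, wordCount_succ]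
    rw [← Equiv.sum_comp ((Equiv.subRight (d : K)).trans (Units.mulLeft (d⁻¹ ^ 2)))
      (fun a => ∑ b, wordCount n ((stepMatrix b)⁻¹ *
        ((stepMatrix a)⁻¹ * ((torusMatrix d)⁻¹ * g))))]
    refine Finset.sum_congr rfl fun a _ => ?_
    rw [← Equiv.sum_comp (Equiv.subRight (d : K)) (fun b => wordCount n ((stepMatrix b)⁻¹ * _))]
    refine Finset.sum_congr rfl fun b _ => ?_
    rw [stepMatrix_mul_inv_mul]
    simp [_root_.mul_inv_rev, mul_assoc]

theorem wordCount_one_torus {K : Type*} [Field K] (d : Kˣ) :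
    wordCount 1 (torusMatrix d) = 0 := by
  have : IsEmpty {c : Fin 1 → K // (List.ofFn fun i => stepMatrix (c i)).prod =
      torusMatrix d} := by
    refine ⟨fun c => ?_⟩
    have := congrArg (fun A : SpecialLinearGroup (Fin 2) K => A.1 1 0) c.2
    simp [coe_stepMatrix, coe_torusMatrix] at this
  unfold wordCount
  exact Nat.card_of_isEmpty

theorem wordCount_two_torus {K : Type*} [Field K] [DecidableEq K] (d : Kˣ) :
    wordCount 2 (torusMatrix d) = if d = -1 then 1 else 0 := by
  unfold wordCount
  have key : ∀ c : Fin 2 → K, (List.ofFn fun i => stepMatrix (c i)).prod = torusMatrix d ↔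
      c = 0 ∧ d = -1 := by
    intro c
    constructor
    · intro h
      have h00 := congrArg (fun A : SpecialLinearGroup (Fin 2) K => A.1 0 0) h
      have h01 := congrArg (fun A : SpecialLinearGroup (Fin 2) K => A.1 0 1) h
      have h10 := congrArg (fun A : SpecialLinearGroup (Fin 2) K => A.1 1 0) h
      simp only [List.ofFn_succ, List.ofFn_zero, List.prod_cons, List.prod_nil, mul_one,
        Matrix.SpecialLinearGroup.coe_mul, coe_stepMatrix, coe_torusMatrix] at h00 h01 h10
      simp at h00 h01 h10
      refine ⟨?_, Units.ext ?_⟩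
      · ext i
        fin_cases i <;> simp [h01, h10]
      · simpa [h01] using h00.symm
    · rintro ⟨rfl, rfl⟩
      ext i j
      fin_cases i <;> fin_cases j <;> simp [coe_stepMatrix, coe_torusMatrix, inv_neg]
  simp only [key]
  split_ifs with h <;> simp [h]

/-- The number of words of length `n` whose product is one of the matrices `D(d)`. -/
noncomputable def torusWordCount (K : Type*) [Field K] [Fintype K] [DecidableEq K] (n : ℕ) : ℕ :=
  ∑ d : Kˣ, wordCount n (torusMatrix d)

theorem torusWordCount_add_three (K : Type*) [Field K] [Fintype K] [DecidableEq K] (n : ℕ) :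
    torusWordCount K (n + 3) = Fintype.card K * torusWordCount K (n + 1) +
      (Fintype.card K - 1) * torusWordCount K (n + 2) := by
  have h : ∀ d : Kˣ, ∑ e : Kˣ, wordCount (n + 2) (torusMatrix e * torusMatrix d) =
      torusWordCount K (n + 2) := by
    intro d
    simp only [torusMatrix_mul]
    exact Equiv.sum_comp (Equiv.mulRight d) (fun e => wordCount (n + 2) (torusMatrix e))
  have h' : ∑ d : Kˣ, wordCount (n + 1) (-torusMatrix d) = torusWordCount K (n + 1) := by
    simp only [neg_torusMatrix]
    exact Equiv.sum_comp (Equiv.neg Kˣ) (fun e => wordCount (n + 1) (torusMatrix e))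
  rw [torusWordCount]
  simp only [wordCount_add_three, h, Finset.sum_add_distrib, ← Finset.mul_sum, h']
  simp [Fintype.card_units]

theorem torusWordCount_succ (K : Type*) [Field K] [Fintype K] [DecidableEq K] (k : ℕ) :
    ((Fintype.card K : ℚ) + 1) * torusWordCount K (k + 1) =
      (Fintype.card K : ℚ) ^ k - (-1) ^ k := by
  induction k using Nat.twoStepInduction with
  | zero => simp [torusWordCount, wordCount_one_torus]
  | one => simp [torusWordCount, wordCount_two_torus]
  | more k h0 h1 =>
    rw [torusWordCount_add_three]
    push_cast [Nat.cast_sub Fintype.card_pos]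
    linear_combination (Fintype.card K : ℚ) * h0 + ((Fintype.card K : ℚ) - 1) * h1

theorem wordCount_add_three_torus {K : Type*} [Field K] [Fintype K] [DecidableEq K] (n : ℕ)
    (d : Kˣ) :
    wordCount (n + 3) (torusMatrix d) = Fintype.card K * wordCount (n + 1) (torusMatrix (-d)) +
      torusWordCount K (n + 2) := by
  rw [wordCount_add_three, neg_torusMatrix]
  simp only [torusMatrix_mul]
  congr 1
  exact Equiv.sum_comp (Equiv.mulRight d) (fun e => wordCount (n + 2) (torusMatrix e))

theorem wordCount_odd {K : Type*} [Field K] [Fintype K] [DecidableEq K] (m : ℕ) (d : Kˣ) :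
    (wordCount (2 * m + 1) (torusMatrix d) : ℚ) = qInteger ((Fintype.card K : ℚ) ^ 2) m := by
  have hq : (1 : ℚ) < Fintype.card K := by exact_mod_cast Fintype.one_lt_card
  have hq' : ((Fintype.card K : ℚ) ^ 2 - 1) ≠ 0 := by nlinarith
  rw [qInteger, eq_div_iff hq']
  induction m generalizing d with
  | zero => simp [wordCount_one_torus]
  | succ m ih =>
    rw [show 2 * (m + 1) + 1 = 2 * m + 3 by ring, wordCount_add_three_torus]
    have hS := torusWordCount_succ K (2 * m + 1)
    rw [Odd.neg_one_pow ⟨m, rfl⟩] at hS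
    push_cast
    linear_combination (Fintype.card K : ℚ) * ih (-d) + ((Fintype.card K : ℚ) - 1) * hS

/-- The base case `n = 2` carries the sign: `M(a) M(b) = D(d)` forces `a = b = 0` and `d = -1`,
and every step of the recursion negates `d`. -/
theorem wordCount_even {K : Type*} [Field K] [Fintype K] [DecidableEq K] (k : ℕ) (d : Kˣ) :
    (wordCount (2 * k + 2) (torusMatrix d) : ℚ) =
      ((Fintype.card K : ℚ) - 1) * qBinomialTwo (Fintype.card K : ℚ) (k + 1) +
        if d = (-1) ^ (k + 1) then (Fintype.card K : ℚ) ^ k else 0 := by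
  have hq : (1 : ℚ) < Fintype.card K := by exact_mod_cast Fintype.one_lt_card
  have hq1 : ((Fintype.card K : ℚ) - 1) ≠ 0 := by linarith
  have hq2 : ((Fintype.card K : ℚ) ^ 2 - 1) ≠ 0 := by nlinarith
  have hq3 : ((Fintype.card K : ℚ) + 1) ≠ 0 := by linarith
  induction k generalizing d with
  | zero => simp [wordCount_two_torus, qBinomialTwo]
  | succ k ih =>
    rw [show 2 * (k + 1) + 2 = 2 * k + 1 + 3 by ring, wordCount_add_three_torus]
    have hS := torusWordCount_succ K (2 * k + 2)
    rw [Even.neg_one_pow ⟨k + 1, by ring⟩, mul_comm, ← eq_div_iff hq3] at hS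
    have hd : -d = (-1) ^ (k + 1) ↔ d = (-1) ^ (k + 1 + 1) := by
      rw [neg_eq_iff_eq_neg, pow_succ (-1 : Kˣ) (k + 1), mul_neg_one]
    push_cast
    rw [ih (-d), hS]
    simp only [hd, qBinomialTwo, Nat.add_sub_cancel]
    split_ifs <;> field_simp <;> ring

/-! ### Products along a bi-infinite sequence -/

/-- The bi-infinite product `T_j` of the matrices `M(c_i)`, determined by `T_0 = 1` and
`T_{j+1} = T_j M(c_j)`. Writing `v_j` for its first column, its second column is `-v_{j-1}`, and
`v_{j+1} = c_j v_j - v_{j-1}`. -/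
def transfer {R : Type*} [CommRing R] (c : ℤ → R) : ℤ → SpecialLinearGroup (Fin 2) R
  | .ofNat k => (List.ofFn fun i : Fin k => stepMatrix (c (i : ℕ))).prod
  | .negSucc k => (List.ofFn fun i : Fin (k + 1) => (stepMatrix (c (-(i : ℕ) - 1)))⁻¹).prod

theorem transfer_zero {R : Type*} [CommRing R] (c : ℤ → R) : transfer c 0 = 1 :=
  rfl

theorem transfer_natCast {R : Type*} [CommRing R] (c : ℤ → R) (n : ℕ) :
    transfer c n = (List.ofFn fun i : Fin n => stepMatrix (c (i : ℕ))).prod :=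
  rfl

theorem transfer_add_one {R : Type*} [CommRing R] (c : ℤ → R) (j : ℤ) :
    transfer c (j + 1) = transfer c j * stepMatrix (c j) := by
  rcases j with k | _ | k
  · change (List.ofFn fun i : Fin (k + 1) => stepMatrix (c (i : ℕ))).prod = _
    rw [List.ofFn_succ', List.concat_eq_append, List.prod_append]
    simp [transfer]
  · change (1 : SpecialLinearGroup (Fin 2) R) = _
    simp [transfer]
  · rw [show Int.negSucc (k + 1) + 1 = Int.negSucc k by omega]
    simp only [transfer]
    rw [List.ofFn_succ' (n := k + 1), List.concat_eq_append, List.prod_append]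
    have : (-((k + 1 : ℕ) : ℤ) - 1) = Int.negSucc (k + 1) := by omega
    simp only [Fin.val_castSucc, Fin.val_last, List.prod_singleton, this,
      inv_mul_cancel_right]

theorem transfer_add_one_zero {R : Type*} [CommRing R] (c : ℤ → R) (j : ℤ) (r : Fin 2) :
    transfer c (j + 1) r 0 = c j * transfer c j r 0 + transfer c j r 1 := by
  simp [transfer_add_one, coe_stepMatrix, Matrix.mul_apply, Fin.sum_univ_two, mul_comm]

theorem transfer_one {R : Type*} [CommRing R] (c : ℤ → R) (j : ℤ) (r : Fin 2) :
    transfer c j r 1 = -transfer c (j - 1) r 0 := by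
  obtain ⟨j, rfl⟩ : ∃ k, j = k + 1 := ⟨j - 1, by ring⟩
  simp [transfer_add_one, coe_stepMatrix, Matrix.mul_apply, Fin.sum_univ_two]

/-- The determinant `det (v_j, v_i)`, where `v_j` is the first column of `transfer c j`. -/
def columnDet {R : Type*} [CommRing R] (c : ℤ → R) (i j : ℤ) : R :=
  transfer c j 0 0 * transfer c i 1 0 - transfer c i 0 0 * transfer c j 1 0

theorem columnDet_self {R : Type*} [CommRing R] (c : ℤ → R) (i : ℤ) : columnDet c i i = 0 := by
  simp [columnDet]

theorem columnDet_add_one_self {R : Type*} [CommRing R] (c : ℤ → R) (i : ℤ) :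
    columnDet c (i + 1) i = 1 := by
  have h := (transfer c i).2
  rw [Matrix.det_fin_two] at h
  rw [columnDet, transfer_add_one_zero, transfer_add_one_zero]
  linear_combination h

theorem columnDet_swap {R : Type*} [CommRing R] (c : ℤ → R) (i j : ℤ) :
    columnDet c i j = -columnDet c j i := by
  simp only [columnDet]
  ring

theorem columnDet_sub_one {R : Type*} [CommRing R] (c : ℤ → R) (i j : ℤ) :
    columnDet c i (j - 1) = c j * columnDet c i j - columnDet c i (j + 1) := by
  simp only [columnDet, transfer_add_one_zero, transfer_one]
  ring

theorem columnDet_add_one_sub_one {R : Type*} [CommRing R] (c : ℤ → R) (j : ℤ) :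
    columnDet c (j + 1) (j - 1) = c j := by
  rw [columnDet_sub_one, columnDet_self, columnDet_add_one_self]
  ring

/-- The Plücker relation, since consecutive columns have determinant `1`. -/
theorem columnDet_diamond {R : Type*} [CommRing R] (c : ℤ → R) (i j : ℤ) :
    columnDet c i j * columnDet c (i + 1) (j + 1) -
      columnDet c i (j + 1) * columnDet c (i + 1) j = 1 := by
  have hP : columnDet c i j * columnDet c (i + 1) (j + 1) -
      columnDet c i (j + 1) * columnDet c (i + 1) j =
      columnDet c (i + 1) i * columnDet c (j + 1) j := by
    simp only [columnDet]
    ring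
  rw [hP, columnDet_add_one_self, columnDet_add_one_self, one_mul]

theorem columnDet_add_of_antiperiodic {R : Type*} [CommRing R] {c : ℤ → R} {n : ℤ}
    (h : ∀ j, transfer c (j + n) = -transfer c j) (i j : ℤ) :
    columnDet c (i + n) j = -columnDet c i j := by
  simp only [columnDet, h, SpecialLinearGroup.coe_neg, Matrix.neg_apply]
  ring

theorem transfer_antiperiodic {R : Type*} [CommRing R] {c : ℤ → R} {n : ℤ}
    (hc : Function.Periodic c n) (h : transfer c n = -1) (j : ℤ) :
    transfer c (j + n) = -transfer c j := by
  induction j using Int.induction_on with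
  | zero => rw [zero_add, h, transfer_zero]
  | succ i ih =>
    rw [add_right_comm, transfer_add_one, ih, hc, transfer_add_one, neg_mul]
  | pred i ih =>
    have h1 := transfer_add_one c (-(i : ℤ) - 1 + n)
    have h2 := transfer_add_one c (-(i : ℤ) - 1)
    rw [hc, show -(i : ℤ) - 1 + n + 1 = -i + n by ring, ih] at h1
    rw [sub_add_cancel] at h2
    rw [h2, ← neg_mul] at h1
    exact (mul_right_cancel h1).symm

theorem periodic_of_transfer_antiperiodic {R : Type*} [CommRing R] {c : ℤ → R} {n : ℤ}
    (h : ∀ j, transfer c (j + n) = -transfer c j) : Function.Periodic c n := by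
  intro j
  have h1 := transfer_add_one c (j + n)
  rw [add_right_comm, h, h, transfer_add_one, ← neg_mul] at h1
  exact (stepMatrix_injective (mul_left_cancel h1)).symm

/-- If the columns satisfy the boundary conditions of the last two rows of a regular frieze, then
`v_{j+n} = -v_j`. -/
theorem transfer_antiperiodic_of_columnDet {R : Type*} [CommRing R] {c : ℤ → R} {n : ℤ}
    (h0 : ∀ j, columnDet c (n + j) j = 0) (h1 : ∀ j, columnDet c (n + j - 1) j = 1) (j : ℤ) :
    transfer c (j + n) = -transfer c j := by
  have key : ∀ (k : ℤ) (r : Fin 2),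
      transfer c (k + n) r 0 = -transfer c k r 0 := by
    intro k r
    have a := columnDet_add_one_self c k
    have b := h0 k
    have d := h1 (k + 1)
    rw [show n + (k + 1) - 1 = k + n by ring] at d
    rw [add_comm] at b
    simp only [columnDet] at a b d
    -- `v = det (u, v) w - det (w, v) u` for `det (u, w) = 1`, with `u = v_k`, `w = v_{k+1}` and
    -- `v = v_{k+n}`.
    fin_cases r
    · simp only [Fin.zero_eta]
      linear_combination transfer c (k + 1) 0 0 * b - transfer c k 0 0 * d -
        transfer c (k + n) 0 0 * a
    · simp only [Fin.mk_one]
      linear_combination transfer c (k + 1) 1 0 * b - transfer c k 1 0 * d -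
        transfer c (k + n) 1 0 * a
  ext r s
  rw [SpecialLinearGroup.coe_neg, Matrix.neg_apply]
  fin_cases s
  · exact key j r
  · simp only [Fin.mk_one]
    rw [transfer_one, transfer_one, ← key (j - 1), sub_add_eq_add_sub]

namespace Frieze

/-! ### Friezes and their quiddity sequences -/

/-- The frieze with entries `m_{i,j} = det (v_j, v_i)`, for antiperiodic columns `v_j`. -/
def ofQuiddity {R : Type*} [CommRing R] {n : ℕ} (c : ℤ → R)
    (h : ∀ j, transfer c (j + n) = -transfer c j) : Frieze R n where
  toFun p := columnDet c p.1.1 p.1.2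
  top_row i := columnDet_self c i
  bottom_row i := by
    change columnDet c (n + i) i = 0
    rw [add_comm, columnDet_add_of_antiperiodic h, columnDet_self, neg_zero]
  diamond i j _ _ := columnDet_diamond c i j

theorem ofQuiddity_entry {R : Type*} [CommRing R] {n : ℕ} (c : ℤ → R)
    (h : ∀ j, transfer c (j + n) = -transfer c j) (i j : ℤ) (h₀ : 0 ≤ i - j) (h₁ : i - j ≤ n) :
    (ofQuiddity c h).entry i j h₀ h₁ = columnDet c i j :=
  rfl

theorem isTame_ofQuiddity {R : Type*} [CommRing R] {n : ℕ} (c : ℤ → R)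
    (h : ∀ j, transfer c (j + n) = -transfer c j) : (ofQuiddity c h).IsTame := by
  intro i j _ _
  rw [Matrix.det_fin_three]
  simp only [ofQuiddity_entry, columnDet, Matrix.of_apply, Matrix.cons_val]
  ring

theorem isRegular_ofQuiddity {R : Type*} [CommRing R] {n : ℕ} (c : ℤ → R)
    (h : ∀ j, transfer c (j + n) = -transfer c j) : (ofQuiddity c h).IsRegular := by
  intro _ i
  refine ⟨columnDet_add_one_self c i, ?_⟩
  rw [ofQuiddity_entry, show (n : ℤ) + i - 1 = i - 1 + n by ring,
    columnDet_add_of_antiperiodic h, columnDet_swap, neg_neg]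
  simpa using columnDet_add_one_self c (i - 1)

/-- The quiddity sequence of a frieze, its third row, indexed so that `c_j = m_{j+1,j-1}`. -/
def quiddity {R : Type*} [CommRing R] {n : ℕ} (hn : 2 ≤ n) (F : Frieze R n) (j : ℤ) : R :=
  F.entry (j + 1) (j - 1) (by omega) (by omega)

theorem quiddity_ofQuiddity {R : Type*} [CommRing R] {n : ℕ} (hn : 2 ≤ n) (c : ℤ → R)
    (h : ∀ j, transfer c (j + n) = -transfer c j) : (ofQuiddity c h).quiddity hn = c :=
  funext (columnDet_add_one_sub_one c)

/-- Three neighbouring columns of a tame frieze satisfy `m_{i,j-1} = c_j m_{i,j} - m_{i,j+1}`. The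
rows `i = j + 1`, `j + 2` are the boundary and the diamond rule; tameness and the diamond rule
propagate the relation from two rows to the next. The function `m` need only satisfy the rules of
a frieze on the strip `0 ≤ i - j ≤ n`. -/
theorem column_recurrence {R : Type*} [CommRing R] {m : ℤ → ℤ → R} {n : ℤ}
    (top : ∀ i, m i i = 0) (one : ∀ i, m (i + 1) i = 1)
    (diamond : ∀ i j, 0 < i - j → i - j < n →
      m i j * m (i + 1) (j + 1) - m i (j + 1) * m (i + 1) j = 1)
    (tame : ∀ i j, 1 < i - j → i - j < n - 1 → Matrix.det
      !![m (i - 1) (j - 1), m (i - 1) j, m (i - 1) (j + 1);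
        m i (j - 1), m i j, m i (j + 1);
        m (i + 1) (j - 1), m (i + 1) j, m (i + 1) (j + 1)] = 0)
    (j : ℤ) (k : ℕ) (hk : k + 1 < n) :
    m (j + 1 + k) (j - 1) =
      m (j + 1) (j - 1) * m (j + 1 + k) j - m (j + 1 + k) (j + 1) := by
  induction k using Nat.twoStepInduction with
  | zero => simp [top, one]
  | one =>
    have h := diamond (j + 1) (j - 1) (by omega) (by push_cast at hk; omega)
    rw [sub_add_cancel, one] at h
    rw [Nat.cast_one, one]
    linear_combination -h
  | more k ih0 ih1 =>
    have h0 := ih0 (by omega)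
    have h1 := ih1 (by omega)
    obtain ⟨i, hi⟩ : ∃ i : ℤ, i = j + 1 + (k + 1) := ⟨_, rfl⟩
    rw [show j + 1 + ((k + 1 : ℕ) : ℤ) = i by push_cast; omega] at h1
    rw [show j + 1 + (k : ℤ) = i - 1 by omega] at h0
    rw [show j + 1 + ((k + 2 : ℕ) : ℤ) = i + 1 by push_cast; omega]
    push_cast at hk
    have hd := diamond (i - 1) j (by omega) (by omega)
    have ht := tame i j (by omega) (by omega)
    rw [sub_add_cancel] at hd
    rw [Matrix.det_fin_three] at ht
    simp only [Matrix.of_apply, Matrix.cons_val] at ht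
    -- Replace the first column by its combination with the other two: the entries of the rows
    -- `i - 1` and `i` vanish, and the cofactor of the entry of row `i + 1` is `1`.
    linear_combination ht -
      (m i j * m (i + 1) (j + 1) - m i (j + 1) * m (i + 1) j) * h0 +
      (m (i - 1) j * m (i + 1) (j + 1) - m (i - 1) (j + 1) * m (i + 1) j) * h1 -
      (m (i + 1) (j - 1) - m (j + 1) (j - 1) * m (i + 1) j + m (i + 1) (j + 1)) * hd

/-- Every tame regular frieze is the frieze of its quiddity sequence. -/
theorem entry_eq_columnDet {R : Type*} [CommRing R] {n : ℕ} (hn : 2 ≤ n) {F : Frieze R n}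
    (ht : F.IsTame) (hr : F.IsRegular) (i j : ℤ) (h₀ : 0 ≤ i - j) (h₁ : i - j ≤ n) :
    F.entry i j h₀ h₁ = columnDet (F.quiddity hn) i j := by
  -- Extend the frieze by junk values outside the strip.
  obtain ⟨m, hm⟩ : ∃ m : ℤ → ℤ → R, ∀ i j h₀ h₁, F.entry i j h₀ h₁ = m i j :=
    ⟨fun i j => if h : 0 ≤ i - j ∧ i - j ≤ n then F.entry i j h.1 h.2 else 0,
      fun i j h₀ h₁ => by simp only [h₀, h₁, and_self, dite_true]⟩
  have top : ∀ i, m i i = 0 := fun i => by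
    rw [← hm i i (by omega) (by omega)]
    exact F.top_row i
  have one : ∀ i, m (i + 1) i = 1 := fun i => by
    rw [← hm (i + 1) i (by omega) (by omega)]
    exact (hr (by omega) i).1
  have diamond : ∀ i j : ℤ, 0 < i - j → i - j < n →
      m i j * m (i + 1) (j + 1) - m i (j + 1) * m (i + 1) j = 1 := fun i j h h' => by
    have := F.diamond i j h h'
    change F.entry _ _ _ _ * F.entry _ _ _ _ - F.entry _ _ _ _ * F.entry _ _ _ _ = 1 at this
    simpa only [hm] using this
  have hrec := column_recurrence top one diamond fun i j h h' => by
    have := ht i j h h'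
    simpa only [hm] using this
  have key : ∀ k : ℕ, k ≤ n → m i (i - k) = columnDet (F.quiddity hn) i (i - k) := by
    intro k
    induction k using Nat.twoStepInduction with
    | zero => simp [top, columnDet_self]
    | one =>
      intro _
      have h1 := one (i - 1)
      have h2 := columnDet_add_one_self (F.quiddity hn) (i - 1)
      rw [sub_add_cancel] at h1 h2
      rw [Nat.cast_one, h1, h2]
    | more k ih0 ih1 =>
      intro hk
      have h0 := ih0 (by omega)
      have h1 := ih1 (by omega)
      obtain ⟨l, hl⟩ : ∃ l : ℤ, l = i - k - 1 := ⟨_, rfl⟩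
      have h2 := hrec l k (by omega)
      rw [show l + 1 + (k : ℤ) = i by omega] at h2
      rw [show i - (k : ℤ) = l + 1 by omega] at h0
      rw [show i - ((k + 1 : ℕ) : ℤ) = l by push_cast; omega] at h1
      rw [show i - ((k + 2 : ℕ) : ℤ) = l - 1 by push_cast; omega]
      rw [h2, columnDet_sub_one, h0, h1, quiddity, hm]
  rw [hm]
  have := key (i - j).toNat (by omega)
  rwa [show i - ((i - j).toNat : ℤ) = j by omega] at this

theorem transfer_quiddity {R : Type*} [CommRing R] {n : ℕ} (hn : 2 ≤ n) {F : Frieze R n}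
    (ht : F.IsTame) (hr : F.IsRegular) (j : ℤ) :
    transfer (F.quiddity hn) (j + n) = -transfer (F.quiddity hn) j := by
  refine transfer_antiperiodic_of_columnDet (fun j => ?_) (fun j => ?_) j
  · rw [← entry_eq_columnDet hn ht hr _ _ (by omega) (by omega)]
    exact F.bottom_row j
  · rw [← entry_eq_columnDet hn ht hr _ _ (by omega) (by omega)]
    exact (hr (by omega) j).2

theorem eq_of_quiddity_eq {R : Type*} [CommRing R] {n : ℕ} (hn : 2 ≤ n) {F G : Frieze R n}
    (hF : F.IsTame ∧ F.IsRegular) (hG : G.IsTame ∧ G.IsRegular)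
    (h : F.quiddity hn = G.quiddity hn) : F = G := by
  refine Frieze.ext (funext fun p => ?_)
  obtain ⟨⟨i, j⟩, h₀, h₁⟩ := p
  change F.entry i j h₀ h₁ = G.entry i j h₀ h₁
  rw [entry_eq_columnDet hn hF.1 hF.2, entry_eq_columnDet hn hG.1 hG.2, h]

/-- One period of the quiddity sequence of a tame regular frieze, a word with product `-1`. -/
def quiddityCycle {R : Type*} [CommRing R] {n : ℕ} (hn : 2 ≤ n)
    (F : {F : Frieze R n // F.IsTame ∧ F.IsRegular}) :
    {c : Fin n → R // (List.ofFn fun i => stepMatrix (c i)).prod = -1} :=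
  ⟨fun i => F.1.quiddity hn (i : ℕ), by
    have h := transfer_quiddity hn F.2.1 F.2.2 0
    rwa [zero_add, transfer_zero, transfer_natCast] at h⟩

theorem quiddityCycle_bijective {R : Type*} [CommRing R] {n : ℕ} (hn : 2 ≤ n) :
    Function.Bijective (quiddityCycle (R := R) hn) := by
  have hn0 : (n : ℤ) ≠ 0 := by omega
  have hlt : ∀ j : ℤ, (j % n).toNat < n := fun j => by
    have := Int.emod_lt_of_pos j (show (0 : ℤ) < n by omega)
    omega
  constructor
  · intro F G h
    refine Subtype.ext (eq_of_quiddity_eq hn F.2 G.2 (funext fun j => ?_))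
    have hFj := (periodic_of_transfer_antiperiodic (transfer_quiddity hn F.2.1 F.2.2)).sub_zsmul_eq
      (x := j) (j / n)
    have hGj := (periodic_of_transfer_antiperiodic (transfer_quiddity hn G.2.1 G.2.2)).sub_zsmul_eq
      (x := j) (j / n)
    have hj : j - (j / n) • (n : ℤ) = ((j % n).toNat : ℤ) := by
      rw [Int.toNat_of_nonneg (Int.emod_nonneg j hn0), Int.emod_def, smul_eq_mul, mul_comm]
    rw [← hFj, ← hGj, hj]
    exact congrFun (congrArg Subtype.val h) ⟨_, hlt j⟩
  · rintro ⟨c, hc⟩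
    let e : ℤ → R := fun j => c ⟨(j % n).toNat, hlt j⟩
    have he : ∀ i : Fin n, e (i : ℕ) = c i := fun i => by
      refine congrArg c (Fin.ext ?_)
      simp only [← Int.natCast_emod, Int.toNat_natCast]
      exact Nat.mod_eq_of_lt i.2
    have hp : Function.Periodic e n := fun j => by
      simp only [e, Int.add_emod_right]
    have hT : transfer e n = -1 := by
      rw [transfer_natCast, ← hc]
      simp only [he]
    refine ⟨⟨ofQuiddity e (transfer_antiperiodic hp hT), isTame_ofQuiddity _ _,
      isRegular_ofQuiddity _ _⟩, Subtype.ext (funext fun i => ?_)⟩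
    change (ofQuiddity e (transfer_antiperiodic hp hT)).quiddity hn (i : ℕ) = c i
    rw [quiddity_ofQuiddity, he]

end Frieze

/-! ### The number of friezes -/

theorem theorem11p1 {R : Type*} [Field R] [Finite R] (q : ℕ) (hq : Nat.card R = q)
    (n : ℕ) (hn : 2 ≤ n) :
    Finite {F : Frieze R n // F.IsTame ∧ F.IsRegular} ∧
    (∀ m : ℕ, n = 2 * m + 1 →
      (Nat.card {F : Frieze R n // F.IsTame ∧ F.IsRegular} : ℚ) = qInteger ((q : ℚ) ^ 2) m) ∧
    (∀ m : ℕ, n = 2 * m → Even m → ringChar R ≠ 2 →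
      (Nat.card {F : Frieze R n // F.IsTame ∧ F.IsRegular} : ℚ) =
        ((q : ℚ) - 1) * qBinomialTwo (q : ℚ) m) ∧
    (∀ m : ℕ, n = 2 * m → (Odd m ∨ ringChar R = 2) →
      (Nat.card {F : Frieze R n // F.IsTame ∧ F.IsRegular} : ℚ) =
        ((q : ℚ) - 1) * qBinomialTwo (q : ℚ) m + (q : ℚ) ^ (m - 1)) := by
  classical
  have := Fintype.ofFinite R
  rw [Nat.card_eq_fintype_card] at hq
  subst hq
  have hbij := Frieze.quiddityCycle_bijective (R := R) hn
  have hcard : Nat.card {F : Frieze R n // F.IsTame ∧ F.IsRegular} =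
      wordCount n (torusMatrix (-1 : Rˣ)) := by
    rw [← neg_torusMatrix, torusMatrix_one]
    exact Nat.card_eq_of_bijective _ hbij
  have hone : ringChar R = 2 ↔ (-1 : Rˣ) = 1 := by
    rw [Units.ext_iff, Units.val_neg, Units.val_one]
    exact ⟨fun h => have := ringChar.of_eq h; CharTwo.neg_eq 1,
      fun h => by_contra fun h' => Ring.neg_one_ne_one_of_char_ne_two h' h⟩
  refine ⟨Finite.of_injective _ hbij.1, ?_, ?_, ?_⟩
  · rintro m rfl
    rw [hcard, wordCount_odd]
  · rintro m rfl hm hR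
    obtain ⟨k, rfl⟩ : ∃ k, m = k + 1 := ⟨m - 1, by omega⟩
    rw [hcard, mul_add_one, wordCount_even, hm.neg_one_pow, if_neg (hone.not.mp hR), add_zero]
  · rintro m rfl hm
    obtain ⟨k, rfl⟩ : ∃ k, m = k + 1 := ⟨m - 1, by omega⟩
    have hsign : (-1 : Rˣ) = (-1) ^ (k + 1) := by
      rcases hm with hm | hR
      · rw [hm.neg_one_pow]
      · rw [hone.mp hR, one_pow]
    rw [hcard, mul_add_one, wordCount_even, if_pos hsign, Nat.add_sub_cancel]
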